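/- **Setting.** Let $p\ge 1$, and let $H_o$ be the joint law of $(y,\mathbf x)\in\mathbb R\times\mathbb R^p$ with $y=u$ independent of $\mathbf x$ (a linear model with true intercept and slope normalized to $0$). Assume: - A1: the law of $u$ is absolutely continuous with a density that is symmetric, continuous and strictly decreasing on $(0,\infty)$; - A2: $P(\mathbf x'\boldsymbol\theta=c)<1$ for all $\boldsymbol\theta\ne\mathbf 0$, $c\in\mathbb R$; - A3: each of $\rho_1,\rho_2$ is symmetric, nondecreasing on $[0,\infty)$, vanishes at $0$, tends to $1$ at $\infty$, and has finitely many discontinuities. Suppose $\rho_1\ge\rho_2$ pointwise, put $b=E\rho_1(u)$, and let $0<\varepsilon<1$, $V_\varepsilon=\{(1-\varepsilon)H_o+\varepsilon H^*: H^* \text{ a probability distribution on }\mathbb R^{p+1}\}$. **Estimates.** For a distribution $H$ on $\mathbb R^{p+1}$ let $\sigma_H(\alpha,\boldsymbol\theta)=\inf\{\sigma>0: E_H\rho_1((y-\alpha-\mathbf x'\boldsymbol\theta)/\sigma)\le b\}$ and $s(H)=\inf_{\alpha,\boldsymbol\theta}\sigma_H(\alpha,\boldsymbol\theta)$. - An S-estimate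 of slope $\mathbf T_S(H)$ is the slope component of some $(\alpha,\boldsymbol\theta)$ with $\sigma_H(\alpha,\boldsymbol\theta)=s(H)>0$. - An MM-estimate of slope $\mathbf T_{MM}(H)$ is the slope component of some minimizer of $(\alpha,\boldsymbol\theta)\mapsto E_H\rho_2((y-\alpha-\mathbf x'\boldsymbol\theta)/s(H))$, where $s(H)>0$ is required. Each functional is an arbitrary selection among the solutions, and it is undefined at $H$ exactly when there is no solution. The maximum bias is $B_{\mathbf T}(\varepsilon)=\sup_{H\in V_\varepsilon}\|\mathbf T(H)\|$ (Euclidean norm), where $\|\mathbf T(H)\|:=\infty$ if $\mathbf T$ is undefined at $H$. Write $B_S$ and $B_{MM}$ for the maximum biases of $\mathbf T_S$ and $\mathbf T_{MM}$. **Bounding functions.** Let $\underline s=\inf_{V_\varepsilon}s(H)$, $\bar s=\sup_{V_\varepsilon}s(H)$, $$m(t,s)=\inf_{\|\boldsymbol\theta\|=t}\inf_{\alpha\in\mathbb R}E_{H_o}\rho_2\Big(\frac{y-\alpha-\mathbf x'\boldsymbol\theta}{s}\Big)-E_{H_o}\rho_2\Big(\frac ys\Big),$$ $h_1(t)=m(t,\bar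 s)$, $h_2(t)=\inf_{\underline s\le s\le\bar s}m(t,s)$, and $h_i^{-1}(v)=\inf\{t\ge0:h_i(t)\ge v\}\in[0,\infty]$ (with $\inf\emptyset=\infty$). **Theorem 3.1.** Assume $B_S(\varepsilon)<h_1^{-1}(\varepsilon/(1-\varepsilon))$. Then: 1. $h_1^{-1}\big(\tfrac{\varepsilon}{1-\varepsilon}\big)\le B_{MM}(\varepsilon)$. 2. $\|\mathbf T_{MM}(H)\|\le h_2^{-1}\big(\tfrac{\varepsilon}{1-\varepsilon}\big)$ for every $H\in V_\varepsilon$ at which $\mathbf T_{MM}$ is defined; and $B_{MM}(\varepsilon)\le h_2^{-1}\big(\tfrac{\varepsilon}{1-\varepsilon}\big)$ whenever $\mathbf T_{MM}$ is defined on all of $V_\varepsilon$ or $\rho_2$ is lower semicontinuous (in particular, whenever $\rho_2$ is continuous). 3. In particular $B_S(\varepsilon)<B_{MM}(\varepsilon)$. -/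

import Mathlib

open MeasureTheory Set Filter Topology
open scoped ENNReal

noncomputable section

namespace MMBias

/-- Regressor space `ℝ^p` with its Euclidean norm. -/
abbrev Reg (p : ℕ) : Type := EuclideanSpace ℝ (Fin p)

/-- Observations `(y, x)`, that is, the space `ℝ^(p+1)` on which the distributions `H` live. -/
abbrev Obs (p : ℕ) : Type := ℝ × Reg p

/-- Condition on the error law: absolutely continuous, with a density `f` that is symmetric,
continuous and strictly decreasing on the positive half-line. -/
def ErrorCondition (F : Measure ℝ) : Prop :=
  ∃ f : ℝ → ℝ, (∀ u, 0 ≤ f u) ∧ (∀ u, f (-u) = f u) ∧ Continuous f ∧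
    StrictAntiOn f (Ioi 0) ∧ F = volume.withDensity (fun u => ENNReal.ofReal (f u))

/-- Condition on the regressor law: no affine hyperplane has full mass. -/
def RegressorCondition {p : ℕ} (G : Measure (Reg p)) : Prop :=
  ∀ θ : Reg p, θ ≠ 0 → ∀ c : ℝ, G {x | inner ℝ x θ = c} < 1

/-- Conditions on a loss function (boundedness by `1` follows from `mono` and `limit`). -/
structure LossCondition (ρ : ℝ → ℝ) : Prop where
  symm : ∀ u, ρ (-u) = ρ u
  mono : MonotoneOn ρ (Ici 0)
  zero : ρ 0 = 0
  limit : Tendsto ρ atTop (𝓝 1)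
  finite_discontinuities : {u | ¬ ContinuousAt ρ u}.Finite

/-- The model distribution of `(y, x)`, with `y = u` (true intercept and slope `0`)
and `u` independent of `x`. -/
def modelLaw {p : ℕ} (F : Measure ℝ) (G : Measure (Reg p)) : Measure (Obs p) := F.prod G

/-- The contamination neighbourhood `{(1 - ε) Ho + ε H' : H' any distribution on ℝ^(p+1)}`. -/
def neighborhood {p : ℕ} (Ho : Measure (Obs p)) (ε : ℝ) : Set (Measure (Obs p)) :=
  {H | ∃ H' : Measure (Obs p), IsProbabilityMeasure H' ∧
    H = ENNReal.ofReal (1 - ε) • Ho + ENNReal.ofReal ε • H'}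

/-- `E_H ρ((y - α - x'θ) / s)`. -/
def risk {p : ℕ} (ρ : ℝ → ℝ) (H : Measure (Obs p)) (α : ℝ) (θ : Reg p) (s : ℝ) : ℝ :=
  ∫ z, ρ ((z.1 - α - inner ℝ z.2 θ) / s) ∂H

/-- `(α, θ, σ)` solves the problem of minimizing the scale `σ > 0` subject to
`E_H ρ((y - α - x'θ) / σ) ≤ b`: the M-scale of the residuals from `(α, θ)`, i.e. the infimum of the
scales feasible for `(α, θ)`, is `σ > 0`, and no feasible scale for any `(α', θ')` is smaller.
If the constraint holds at `σ` itself (as it does for lower semicontinuous `ρ`), this says exactly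
that `(α, θ, σ)` is feasible with the least feasible `σ`. -/
def IsSSolution {p : ℕ} (ρ : ℝ → ℝ) (b : ℝ) (H : Measure (Obs p))
    (α : ℝ) (θ : Reg p) (σ : ℝ) : Prop :=
  0 < σ ∧ IsGLB {σ' | 0 < σ' ∧ risk ρ H α θ σ' ≤ b} σ ∧
    ∀ (α' : ℝ) (θ' : Reg p) (σ' : ℝ), 0 < σ' → risk ρ H α' θ' σ' ≤ b → σ ≤ σ'

/-- The S-functional of scale `s(H)`: the least scale compatible with the S-constraint.
It is the component `σ` of every S-solution at `H`. -/
def sScale {p : ℕ} (ρ : ℝ → ℝ) (b : ℝ) (H : Measure (Obs p)) : ℝ :=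
  sInf {σ | 0 < σ ∧ ∃ (α : ℝ) (θ : Reg p), risk ρ H α θ σ ≤ b}

/-- `(α, θ)` minimizes `E_H ρ₂((y - α - x'θ) / s(H))`, where `s(H)` (which has to be positive)
is the S-functional of scale based on `ρ₁` and `b`. -/
def IsMMSolution {p : ℕ} (ρ₁ ρ₂ : ℝ → ℝ) (b : ℝ) (H : Measure (Obs p))
    (α : ℝ) (θ : Reg p) : Prop :=
  0 < sScale ρ₁ b H ∧ ∀ (α' : ℝ) (θ' : Reg p),
    risk ρ₂ H α θ (sScale ρ₁ b H) ≤ risk ρ₂ H α' θ' (sScale ρ₁ b H)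

/-- A slope functional: `none` means that the functional is not defined at `H`. -/
abbrev SlopeFunctional (p : ℕ) : Type := Measure (Obs p) → Option (Reg p)

/-- `T` is an S-estimate of the slopes: at each distribution it picks the slope of some
S-solution, and it is undefined only where there is none. -/
def IsSFunctional {p : ℕ} (ρ : ℝ → ℝ) (b : ℝ) (T : SlopeFunctional p) : Prop :=
  ∀ H : Measure (Obs p), IsProbabilityMeasure H →
    (∀ θ, T H = some θ → ∃ α σ, IsSSolution ρ b H α θ σ) ∧
    (T H = none → ¬ ∃ α θ σ, IsSSolution ρ b H α θ σ)

/-- `T` is an MM-estimate of the slopes: at each distribution it picks the slope of some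
MM-solution, and it is undefined only where there is none. -/
def IsMMFunctional {p : ℕ} (ρ₁ ρ₂ : ℝ → ℝ) (b : ℝ) (T : SlopeFunctional p) : Prop :=
  ∀ H : Measure (Obs p), IsProbabilityMeasure H →
    (∀ θ, T H = some θ → ∃ α, IsMMSolution ρ₁ ρ₂ b H α θ) ∧
    (T H = none → ¬ ∃ α θ, IsMMSolution ρ₁ ρ₂ b H α θ)

/-- Bias at `H`: the Euclidean norm of the slope, and `∞` where the functional is undefined. -/
def bias {p : ℕ} (T : SlopeFunctional p) (H : Measure (Obs p)) : ℝ≥0∞ :=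
  (T H).elim ⊤ (fun θ => ENNReal.ofReal ‖θ‖)

/-- The maximum bias of `T` over the `ε`-contamination neighbourhood of `Ho`. -/
def maxBias {p : ℕ} (T : SlopeFunctional p) (Ho : Measure (Obs p)) (ε : ℝ) : ℝ≥0∞ :=
  ⨆ H ∈ neighborhood Ho ε, bias T H

/-- The infimum of `s(H)` over the neighbourhood. -/
def sLower {p : ℕ} (ρ₁ : ℝ → ℝ) (b : ℝ) (Ho : Measure (Obs p)) (ε : ℝ) : ℝ :=
  sInf (sScale ρ₁ b '' neighborhood Ho ε)

/-- The supremum of `s(H)` over the neighbourhood. -/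
def sUpper {p : ℕ} (ρ₁ : ℝ → ℝ) (b : ℝ) (Ho : Measure (Obs p)) (ε : ℝ) : ℝ :=
  sSup (sScale ρ₁ b '' neighborhood Ho ε)

/-- `m(t, s) = inf_{‖θ‖ = t} inf_α E_Ho ρ₂((y - α - x'θ) / s) - E_Ho ρ₂(y / s)`. -/
def m {p : ℕ} (ρ₂ : ℝ → ℝ) (Ho : Measure (Obs p)) (t s : ℝ) : ℝ :=
  (⨅ θ : Metric.sphere (0 : Reg p) t, ⨅ α : ℝ, risk ρ₂ Ho α θ s) - ∫ z, ρ₂ (z.1 / s) ∂Ho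

/-- `h₁(t) = m(t, s̄)`. -/
def h₁ {p : ℕ} (ρ₁ ρ₂ : ℝ → ℝ) (b : ℝ) (Ho : Measure (Obs p)) (ε t : ℝ) : ℝ :=
  m ρ₂ Ho t (sUpper ρ₁ b Ho ε)

/-- `h₂(t) = inf_{s̲ ≤ s ≤ s̄} m(t, s)`. -/
def h₂ {p : ℕ} (ρ₁ ρ₂ : ℝ → ℝ) (b : ℝ) (Ho : Measure (Obs p)) (ε t : ℝ) : ℝ :=
  ⨅ s : Icc (sLower ρ₁ b Ho ε) (sUpper ρ₁ b Ho ε), m ρ₂ Ho t s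

/-- Inverse on `[0, ∞)` of an increasing function, with value `∞` at levels it never reaches:
`h⁻¹(v) = inf {t ≥ 0 : h(t) ≥ v}`. If `h` is strictly increasing and `h(t) = v`, this is `t`. -/
def inverse (h : ℝ → ℝ) (v : ℝ) : ℝ≥0∞ :=
  ⨅ t ∈ {t : ℝ | 0 ≤ t ∧ v ≤ h t}, ENNReal.ofReal t

end MMBias

end

/-! Everything rests on one trade-off: at `(1 - ε) Ho + ε H'` a fit can gain at most `ε` over the
true parameters on the contaminated part, while a slope of norm `t` loses at least `(1 - ε) m(t, s)`
on the model part. The function `m(·, s)` is strictly increasing (`m_strictMonoOn`), because the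
expected loss of a location shift grows with its size (`shiftRisk_lt`) and no nonconstant affine
function of `x` is a.s. constant.

Upper bound: if `m(t, s) ≥ ε / (1 - ε)`, any slope longer than `t` loses strictly to the true
parameters (`risk_zero_lt_of_lt_norm`). Since `s(H)` lies between its extremes over the
neighbourhood, `h₂` covers every `H`.

Lower bound: suppose both estimates stay within norm `B < t` and `m(t, s̄) < ε / (1 - ε)`. Place the
contamination at a remote leverage point fitted exactly by a nearly optimal `(α₀, θ₀)` with `‖θ₀‖ =
t`. A slope within `B` then pays nearly `ε` for the outlier, or has a huge intercept and pays nearly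
`1 - ε` on the model (`eventually_lt_risk_contaminate`). Applied to the S-estimate, this drives the
scale up to `s̄` (`tendsto_sScale_sUpper`); applied to the MM-estimate at that scale, it makes `(α₀,
θ₀)` strictly better, a contradiction (`le_m_sUpper`). -/

namespace MMBias

/-! ### Loss functions -/

namespace LossCondition

variable {ρ : ℝ → ℝ}

lemma le_of_abs_le (h : LossCondition ρ) {u v : ℝ} (huv : |u| ≤ |v|) : ρ u ≤ ρ v := by
  have key : ∀ w, ρ |w| = ρ w := fun w => by
    rcases abs_choice w with hw | hw <;> simp [hw, h.symm]
  rw [← key u, ← key v]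
  exact h.mono (abs_nonneg u) (abs_nonneg v) huv

lemma map_abs (h : LossCondition ρ) (u : ℝ) : ρ |u| = ρ u :=
  le_antisymm (h.le_of_abs_le (by simp)) (h.le_of_abs_le (by simp))

lemma nonneg (h : LossCondition ρ) (u : ℝ) : 0 ≤ ρ u := by
  rw [← h.zero]; exact h.le_of_abs_le (by simp)

lemma le_one (h : LossCondition ρ) (u : ℝ) : ρ u ≤ 1 := by
  refine ge_of_tendsto h.limit ?_
  filter_upwards [eventually_ge_atTop |u|] with v hv
  exact h.le_of_abs_le (hv.trans (le_abs_self v))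

lemma measurable (h : LossCondition ρ) : Measurable ρ := by
  have h1 : Monotone fun u : ℝ => ρ (max u 0) := fun u v huv =>
    h.mono (le_max_right u 0) (le_max_right v 0) (max_le_max_right 0 huv)
  have h2 : ρ = (fun u : ℝ => ρ (max u 0)) ∘ fun u => |u| := by
    ext u; simp [h.map_abs]
  rw [h2]
  exact h1.measurable.comp measurable_norm

lemma abs_le_one (h : LossCondition ρ) (u : ℝ) : ‖ρ u‖ ≤ 1 := by
  rw [Real.norm_of_nonneg (h.nonneg u)]; exact h.le_one u

lemma integrable_comp (h : LossCondition ρ) {Ω : Type*} [MeasurableSpace Ω] {μ : Measure Ω}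
    [IsFiniteMeasure μ] {r : Ω → ℝ} (hr : Measurable r) : Integrable (fun z => ρ (r z)) μ :=
  Integrable.of_bound (h.measurable.comp hr).aestronglyMeasurable 1
    (ae_of_all _ fun _ => h.abs_le_one _)

/-- A loss that is not constantly `1` off the origin increases by a shift of any positive length,
on some interval. -/
lemma exists_Ioo_lt_shift (h : LossCondition ρ) (h1 : ∃ δ > 0, ρ δ < 1) {d : ℝ} (hd : 0 < d) :
    ∃ a b, 0 ≤ a ∧ a < b ∧ ∀ w ∈ Ioo a b, ρ w < ρ (w + d) := by
  obtain ⟨δ, hδ, hδ1⟩ := h1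
  -- If no step of length `d / 3` starting from `δ` raised the loss, its limit `1` would be at most
  -- `ρ δ < 1`.
  obtain ⟨k, hk⟩ : ∃ k : ℕ, ρ (δ + k * (d / 3)) < ρ (δ + (k + 1 : ℕ) * (d / 3)) := by
    by_contra! hcon
    have hle : ∀ k : ℕ, ρ (δ + k * (d / 3)) ≤ ρ δ := fun k => by
      induction k with
      | zero => simp
      | succ k ih => exact (hcon k).trans ih
    have hlim : Tendsto (fun k : ℕ => ρ (δ + k * (d / 3))) atTop (𝓝 1) :=
      h.limit.comp (tendsto_atTop_add_const_left _ _
        (tendsto_natCast_atTop_atTop.atTop_mul_const (by positivity)))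
    exact absurd (le_of_tendsto' hlim hle) (not_le.2 hδ1)
  have hk0 : 0 ≤ (k : ℝ) * (d / 3) := by positivity
  -- From the step preceding the rise, a shift by `d` clears the rise; the `max` matters only for
  -- small `k`.
  refine ⟨max 0 (δ + (k - 1) * (d / 3)), δ + k * (d / 3), le_max_left _ _, ?_, ?_⟩
  · exact max_lt (by linarith) (by nlinarith)
  · rintro w ⟨hw1, hw2⟩
    have hw0 := (le_max_left _ _).trans_lt hw1
    have hw3 := (le_max_right _ _).trans_lt hw1
    push_cast at hk
    calc ρ w ≤ ρ (δ + k * (d / 3)) := h.mono hw0.le (by simp; linarith) hw2.le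
      _ < _ := hk
      _ ≤ ρ (w + d) := h.mono (by simp; nlinarith) (by simp; linarith) (by nlinarith)

end LossCondition

/-! ### The error law -/

lemma ErrorCondition.absolutelyContinuous {F : Measure ℝ} (hF : ErrorCondition F) :
    F ≪ volume := by
  obtain ⟨f, -, -, -, -, rfl⟩ := hF
  exact withDensity_absolutelyContinuous _ _

/-- The density of the error law as a function that is strictly decreasing in `|u|`. -/
lemma ErrorCondition.exists_density {F : Measure ℝ} (hF : ErrorCondition F) :
    ∃ f : ℝ → ℝ, (∀ u, 0 < f u) ∧ Measurable f ∧ (∀ u v, |u| < |v| → f v < f u) ∧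
      F = volume.withDensity (fun u => ENNReal.ofReal (f u)) := by
  obtain ⟨f, h0, hs, hc, ha, hf⟩ := hF
  have habs : ∀ u, f |u| = f u := fun u => by
    rcases abs_choice u with hu | hu <;> simp [hu, hs]
  have hlt : ∀ u v, |u| < |v| → f v < f u := by
    intro u v huv
    rw [← habs u, ← habs v]
    rcases (abs_nonneg u).eq_or_lt with hu | hu
    · rw [← hu] at huv ⊢
      -- Monotonicity is assumed only off the origin, so `f 0` is reached as a limit; the
      -- intermediate point `|v| / 2` keeps the inequality strict.
      have hm : f |v| < f (|v| / 2) := ha (show 0 < |v| / 2 by linarith) huv (by linarith)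
      refine hm.trans_le ?_
      have ht : Tendsto f (𝓝[>] 0) (𝓝 (f 0)) := hc.continuousAt.tendsto.mono_left nhdsWithin_le_nhds
      refine ge_of_tendsto ht ?_
      filter_upwards [Ioo_mem_nhdsGT (show (0 : ℝ) < |v| / 2 by linarith)] with w hw
      exact (ha hw.1 (hw.1.trans hw.2) hw.2).le
    · exact ha hu (hu.trans huv) huv
  refine ⟨f, fun u => ?_, hc.measurable, hlt, hf⟩
  exact (h0 (|u| + 1)).trans_lt
    (hlt u (|u| + 1) (by rw [abs_of_pos (by positivity : 0 < |u| + 1)]; linarith))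

lemma ErrorCondition.volume_absolutelyContinuous {F : Measure ℝ} (hF : ErrorCondition F) :
    volume ≪ F := by
  obtain ⟨f, h0, hm, -, rfl⟩ := hF.exists_density
  refine withDensity_absolutelyContinuous' (by fun_prop) (ae_of_all _ fun u => ?_)
  simpa using h0 u

lemma ErrorCondition.ae_ne {F : Measure ℝ} (hF : ErrorCondition F) (c : ℝ) : ∀ᵐ u ∂F, u ≠ c := by
  exact hF.absolutelyContinuous.ae_le (Measure.ae_ne volume c)

/-- `E ρ((u - a) / s)` for `u ~ F`: the expected loss of a location shift `a`. -/
noncomputable def shiftRisk (ρ : ℝ → ℝ) (F : Measure ℝ) (s a : ℝ) : ℝ := ∫ u, ρ ((u - a) / s) ∂F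

section

variable {ρ : ℝ → ℝ} {F : Measure ℝ}

lemma shiftRisk_neg (hρ : LossCondition ρ) (hF : ErrorCondition F) (s a : ℝ) :
    shiftRisk ρ F s (-a) = shiftRisk ρ F s a := by
  obtain ⟨f, h0, hs, hc, -, hFf⟩ := hF
  have hm := hc.measurable
  have hrep : ∀ c, shiftRisk ρ F s c = ∫ u, f u * ρ ((u - c) / s) := fun c => by
    rw [shiftRisk, hFf, integral_withDensity_eq_integral_toReal_smul (by fun_prop)
      (ae_of_all _ fun _ => ENNReal.ofReal_lt_top)]
    simp [ENNReal.toReal_ofReal (h0 _)]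
  rw [hrep, hrep, ← integral_neg_eq_self]
  refine integral_congr_ae (ae_of_all _ fun u => ?_)
  have e : (-u - -a) / s = -((u - a) / s) := by ring
  simp only [e, hρ.symm, hs]

lemma shiftRisk_abs (hρ : LossCondition ρ) (hF : ErrorCondition F) (s a : ℝ) :
    shiftRisk ρ F s |a| = shiftRisk ρ F s a := by
  rcases abs_choice a with ha | ha <;> simp [ha, shiftRisk_neg hρ hF]

variable [IsProbabilityMeasure F]

/-- Reflection about the midpoint of `a` and `a'` swaps the two shifted losses. Pairing `u` with `a
+ a' - u` turns the difference of risks into the integral of a product of two factors of the same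
sign: of the paired points, the one nearer `a` is also nearer the origin, hence has the larger
density. -/
lemma shiftRisk_lt (hρ : LossCondition ρ) (h1 : ∃ δ > 0, ρ δ < 1) (hF : ErrorCondition F)
    {s : ℝ} (hs : 0 < s) {a a' : ℝ} (ha : 0 ≤ a) (haa : a < a') :
    shiftRisk ρ F s a < shiftRisk ρ F s a' := by
  obtain ⟨f, h0, hm, hlt, hFf⟩ := hF.exists_density
  have hrep : ∀ c, shiftRisk ρ F s c = ∫ u, f u * ρ ((u - c) / s) := fun c => by
    rw [shiftRisk, hFf, integral_withDensity_eq_integral_toReal_smul (by fun_prop)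
      (ae_of_all _ fun _ => ENNReal.ofReal_lt_top)]
    simp [ENNReal.toReal_ofReal (h0 _).le]
  have hfi : Integrable f := by
    refine ⟨hm.aestronglyMeasurable, ?_⟩
    rw [hasFiniteIntegral_iff_ofReal (ae_of_all _ fun u => (h0 u).le)]
    have : F univ = 1 := measure_univ
    rw [hFf, withDensity_apply _ MeasurableSet.univ, setLIntegral_univ] at this
    rw [this]; exact ENNReal.one_lt_top
  have hint : ∀ c, Integrable fun u => f u * ρ ((u - c) / s) := fun c =>
    hfi.mul_bdd (c := 1) (hρ.measurable.comp (by fun_prop)).aestronglyMeasurable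
      (ae_of_all _ fun u => hρ.abs_le_one _)
  set Φ : ℝ → ℝ := fun u => f u * ρ ((u - a') / s) - f u * ρ ((u - a) / s) with hΦ
  have hΦi : Integrable Φ := (hint a').sub (hint a)
  have hΦr : ∀ u, Φ u + Φ (a + a' - u) =
      (f u - f (a + a' - u)) * (ρ ((u - a') / s) - ρ ((u - a) / s)) := fun u => by
    have e1 : (a + a' - u - a') / s = -((u - a) / s) := by ring
    have e2 : (a + a' - u - a) / s = -((u - a') / s) := by ring
    simp only [hΦ, e1, e2, hρ.symm]
    ring
  have hsum : ∫ u, (Φ u + Φ (a + a' - u)) =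
      2 * (shiftRisk ρ F s a' - shiftRisk ρ F s a) := by
    rw [integral_add hΦi (hΦi.comp_sub_left _), integral_sub_left_eq_self Φ volume (a + a'),
      hΦ, integral_sub (hint a') (hint a), hrep, hrep]
    ring
  have hpos : 0 < ∫ u, (Φ u + Φ (a + a' - u)) := by
    refine (integral_pos_iff_support_of_nonneg ?_ (hΦi.add (hΦi.comp_sub_left _))).2 ?_
    rotate_left
    · obtain ⟨lo, hi, hlo, hlh, hw⟩ :=
        hρ.exists_Ioo_lt_shift h1 (d := (a' - a) / s) (div_pos (by linarith) hs)
      -- The image under `w ↦ a - s * w` of an interval where the shift by `(a' - a) / s` raises the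
      -- loss.
      have hsub : Ioo (a - s * hi) (a - s * lo) ⊆
          Function.support fun u => Φ u + Φ (a + a' - u) := by
        rintro u ⟨hu1, hu2⟩
        have hu := hw ((a - u) / s)
          ⟨by rw [lt_div_iff₀ hs]; linarith, by rw [div_lt_iff₀ hs]; linarith⟩
        have e1 : (a - u) / s = -((u - a) / s) := by ring
        have e2 : (a - u) / s + (a' - a) / s = -((u - a') / s) := by ring
        rw [e2, e1, hρ.symm, hρ.symm] at hu
        have hua : u < a := by nlinarith
        have hfu : f (a + a' - u) < f u :=
          hlt _ _ (by rw [abs_of_pos (by linarith : 0 < a + a' - u), abs_lt]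
                      constructor <;> linarith)
        rw [Function.mem_support, hΦr]
        exact (mul_pos (sub_pos.2 hfu) (sub_pos.2 hu)).ne'
      refine lt_of_lt_of_le ?_ (measure_mono hsub)
      rw [Real.volume_Ioo, ENNReal.ofReal_pos]
      nlinarith
    · intro u
      simp only [Pi.zero_apply, Pi.add_apply, hΦr]
      rcases lt_trichotomy u ((a + a') / 2) with hu | hu | hu
      · refine mul_nonneg (sub_nonneg.2 (hlt _ _ ?_).le) (sub_nonneg.2 (hρ.le_of_abs_le ?_))
        · rw [abs_of_pos (by linarith : 0 < a + a' - u), abs_lt]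
          constructor <;> linarith
        · rw [abs_div, abs_div]
          refine div_le_div_of_nonneg_right ?_ (abs_nonneg s)
          rw [abs_of_neg (by linarith : u - a' < 0), abs_le]
          constructor <;> linarith
      · rw [show a + a' - u = u by linarith]; simp
      · refine mul_nonneg_of_nonpos_of_nonpos (sub_nonpos.2 (hlt _ _ ?_).le)
          (sub_nonpos.2 (hρ.le_of_abs_le ?_))
        · rw [abs_of_pos (by linarith : 0 < u), abs_lt]
          constructor <;> linarith
        · rw [abs_div, abs_div]
          refine div_le_div_of_nonneg_right ?_ (abs_nonneg s)
          rw [abs_of_pos (by linarith : 0 < u - a), abs_le]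
          constructor <;> linarith
  rw [hsum] at hpos
  linarith

lemma shiftRisk_mul_lt (hρ : LossCondition ρ) (h1 : ∃ δ > 0, ρ δ < 1) (hF : ErrorCondition F)
    {s : ℝ} (hs : 0 < s) {l : ℝ} (hl0 : 0 ≤ l) (hl1 : l < 1) {a : ℝ} (ha : a ≠ 0) :
    shiftRisk ρ F s (l * a) < shiftRisk ρ F s a := by
  rw [← shiftRisk_abs hρ hF s a, ← shiftRisk_abs hρ hF s (l * a), abs_mul, abs_of_nonneg hl0]
  have := abs_pos.2 ha
  exact shiftRisk_lt hρ h1 hF hs (by positivity) (by nlinarith)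

end

/-! ### The risk at a general distribution -/

section

variable {p : ℕ} {ρ : ℝ → ℝ} {H : Measure (Obs p)} [IsProbabilityMeasure H]

lemma measurable_residual (α : ℝ) (θ : Reg p) (s : ℝ) :
    Measurable fun z : Obs p => (z.1 - α - inner ℝ z.2 θ) / s := by
  have : Continuous fun z : Obs p => (z.1 - α - inner ℝ z.2 θ) / s := by fun_prop
  exact this.measurable

lemma LossCondition.integrable_risk (hρ : LossCondition ρ) (α : ℝ) (θ : Reg p) (s : ℝ) :
    Integrable (fun z : Obs p => ρ ((z.1 - α - inner ℝ z.2 θ) / s)) H :=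
  hρ.integrable_comp (measurable_residual α θ s)

lemma LossCondition.risk_nonneg (hρ : LossCondition ρ) (H : Measure (Obs p)) (α : ℝ) (θ : Reg p)
    (s : ℝ) : 0 ≤ risk ρ H α θ s :=
  integral_nonneg fun _ => hρ.nonneg _

lemma integral_le_one_of_le_one {Ω : Type*} [MeasurableSpace Ω] {μ : Measure Ω}
    [IsProbabilityMeasure μ] {g : Ω → ℝ} (h0 : ∀ z, 0 ≤ g z) (h1 : ∀ z, g z ≤ 1) :
    ∫ z, g z ∂μ ≤ 1 := by
  have := integral_mono_of_nonneg (ae_of_all μ h0) (integrable_const 1) (ae_of_all μ h1)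
  simpa using this

lemma LossCondition.risk_le_one (hρ : LossCondition ρ) (α : ℝ) (θ : Reg p) (s : ℝ) :
    risk ρ H α θ s ≤ 1 :=
  integral_le_one_of_le_one (fun _ => hρ.nonneg _) fun _ => hρ.le_one _

lemma LossCondition.risk_anti (hρ : LossCondition ρ) (α : ℝ) (θ : Reg p) {s s' : ℝ} (hs : 0 < s)
    (hss : s ≤ s') : risk ρ H α θ s' ≤ risk ρ H α θ s := by
  refine integral_mono (hρ.integrable_risk α θ s') (hρ.integrable_risk α θ s) fun z => ?_
  refine hρ.le_of_abs_le ?_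
  rw [abs_div, abs_div, abs_of_pos hs, abs_of_pos (hs.trans_le hss)]
  gcongr

/-- The risk tends to `1` as the intercept diverges, uniformly over bounded slopes and scales. -/
lemma LossCondition.exists_intercept_bound (hρ : LossCondition ρ) (H : Measure (Obs p))
    [IsProbabilityMeasure H] {c : ℝ} (hc : c < 1) {S : ℝ} (hS : 0 < S) (B : ℝ) :
    ∃ A : ℝ, 0 ≤ A ∧ ∀ (α : ℝ) (θ : Reg p) (s : ℝ), A ≤ |α| → ‖θ‖ ≤ B → 0 < s → s ≤ S →
      c < risk ρ H α θ s := by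
  -- A lower bound for the absolute scaled residual, uniform over `|α| ≥ A`, `‖θ‖ ≤ B` and `s ≤ S`.
  set w : ℝ → Obs p → ℝ := fun A z => max (A - |z.1| - ‖z.2‖ * B) 0 / S with hw
  have hwm : ∀ A, Measurable (w A) := fun A => by
    have : Continuous (w A) := by fun_prop
    exact this.measurable
  have hlim : Tendsto (fun A => ∫ z, ρ (w A z) ∂H) atTop (𝓝 (∫ _, (1 : ℝ) ∂H)) := by
    refine tendsto_integral_filter_of_dominated_convergence (fun _ => 1)
      (Eventually.of_forall fun A => (hρ.measurable.comp (hwm A)).aestronglyMeasurable)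
      (Eventually.of_forall fun A => ae_of_all _ fun z => hρ.abs_le_one _) (integrable_const _)
      (ae_of_all _ fun z => hρ.limit.comp ?_)
    refine Tendsto.atTop_div_const hS (tendsto_atTop_mono (fun A => le_max_left _ _) ?_)
    simp only [sub_eq_add_neg]
    exact tendsto_atTop_add_const_right _ _ (tendsto_atTop_add_const_right _ _ tendsto_id)
  simp only [integral_const, probReal_univ, smul_eq_mul, mul_one] at hlim
  obtain ⟨A, hA, hA0⟩ := ((hlim.eventually_const_lt hc).and (eventually_ge_atTop 0)).exists
  refine ⟨A, hA0, fun α θ s hα hθ hs hsS => hA.trans_le ?_⟩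
  refine integral_mono (hρ.integrable_comp (hwm A)) (hρ.integrable_risk α θ s) fun z => ?_
  refine hρ.le_of_abs_le ?_
  have hin : |inner ℝ z.2 θ| ≤ ‖z.2‖ * B :=
    (abs_real_inner_le_norm _ _).trans (mul_le_mul_of_nonneg_left hθ (norm_nonneg _))
  have hres : max (A - |z.1| - ‖z.2‖ * B) 0 ≤ |z.1 - α - inner ℝ z.2 θ| := by
    refine max_le ?_ (abs_nonneg _)
    have h1 : |α| ≤ |z.1 - α - inner ℝ z.2 θ| + |z.1| + |inner ℝ z.2 θ| := by
      have h2 := abs_add_three (-(z.1 - α - inner ℝ z.2 θ)) z.1 (-inner ℝ z.2 θ)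
      have e : -(z.1 - α - inner ℝ z.2 θ) + z.1 + -inner ℝ z.2 θ = α := by ring
      rwa [e, abs_neg, abs_neg] at h2
    linarith
  rw [hw, abs_div, abs_div, abs_of_pos hs, abs_of_pos hS, abs_of_nonneg (le_max_right _ _)]
  gcongr

/-- For a lower semicontinuous loss the risk is a lower semicontinuous function of intercept and
slope. -/
lemma LossCondition.lowerSemicontinuous_risk (hρ : LossCondition ρ) (hl : LowerSemicontinuous ρ)
    (s : ℝ) : LowerSemicontinuous fun q : ℝ × Reg p => risk ρ H q.1 q.2 s := by
  set φ : ℝ × Reg p → Obs p → ℝ≥0∞ := fun q z =>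
    ENNReal.ofReal (ρ ((z.1 - q.1 - inner ℝ z.2 q.2) / s)) with hφ
  have hφl : ∀ z, LowerSemicontinuous fun q => φ q z := fun z => by
    have h1 : LowerSemicontinuous fun q : ℝ × Reg p => ρ ((z.1 - q.1 - inner ℝ z.2 q.2) / s) :=
      hl.comp (by fun_prop)
    exact ENNReal.continuous_ofReal.comp_lowerSemicontinuous h1 ENNReal.ofReal_mono
  have hφm : ∀ q, Measurable (φ q) := fun q =>
    (hρ.measurable.comp (measurable_residual q.1 q.2 s)).ennreal_ofReal
  have hrisk : ∀ q : ℝ × Reg p, ENNReal.ofReal (risk ρ H q.1 q.2 s) = ∫⁻ z, φ q z ∂H := fun q =>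
    ofReal_integral_eq_lintegral_ofReal (hρ.integrable_risk q.1 q.2 s)
      (ae_of_all _ fun z => hρ.nonneg _)
  intro q y hy
  by_contra hcon
  rw [not_eventually] at hcon
  -- A sequence is extracted so that Fatou's lemma applies.
  obtain ⟨x, hx, hxy⟩ := exists_seq_forall_of_frequently hcon
  have hle : ENNReal.ofReal (risk ρ H q.1 q.2 s) ≤ ENNReal.ofReal y := by
    calc ENNReal.ofReal (risk ρ H q.1 q.2 s) = ∫⁻ z, φ q z ∂H := hrisk q
      _ ≤ ∫⁻ z, liminf (fun n => φ (x n) z) atTop ∂H := lintegral_mono fun z =>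
          ((hφl z).lowerSemicontinuousAt q).le_liminf.trans (by
            rw [← Function.comp_def (fun q => φ q z) x, liminf_comp]
            exact liminf_le_liminf_of_le hx)
      _ ≤ liminf (fun n => ∫⁻ z, φ (x n) z ∂H) atTop := lintegral_liminf_le fun n => hφm _
      _ ≤ liminf (fun _ : ℕ => ENNReal.ofReal y) atTop := by
          refine liminf_le_liminf (Eventually.of_forall fun n => ?_)
          simp only [← hrisk]
          exact ENNReal.ofReal_le_ofReal (not_lt.1 (hxy n))
      _ = ENNReal.ofReal y := liminf_const _
  have hy0 : 0 ≤ y := (hρ.risk_nonneg H (x 0).1 (x 0).2 s).trans (not_lt.1 (hxy 0))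
  exact absurd ((ENNReal.ofReal_le_ofReal_iff hy0).1 hle) (not_le.2 hy)

end

section

variable {p : ℕ} {ρ : ℝ → ℝ} {Ho : Measure (Obs p)} [IsProbabilityMeasure Ho] {ε : ℝ}

/-- The contaminated distribution `(1 - ε) Ho + ε H'`. -/
noncomputable def contaminate (Ho H' : Measure (Obs p)) (ε : ℝ) : Measure (Obs p) :=
  ENNReal.ofReal (1 - ε) • Ho + ENNReal.ofReal ε • H'

lemma isProbabilityMeasure_contaminate (hε₀ : 0 < ε) (hε₁ : ε < 1) (H' : Measure (Obs p))
    [IsProbabilityMeasure H'] : IsProbabilityMeasure (contaminate Ho H' ε) := by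
  refine ⟨?_⟩
  simp only [contaminate, Measure.add_apply, Measure.smul_apply, measure_univ, smul_eq_mul, mul_one]
  rw [← ENNReal.ofReal_add (by linarith) hε₀.le]
  simp

lemma LossCondition.risk_contaminate (hρ : LossCondition ρ) (hε₀ : 0 < ε) (hε₁ : ε < 1)
    (H' : Measure (Obs p)) [IsProbabilityMeasure H'] (α : ℝ) (θ : Reg p) (s : ℝ) :
    risk ρ (contaminate Ho H' ε) α θ s =
      (1 - ε) * risk ρ Ho α θ s + ε * risk ρ H' α θ s := by
  rw [risk, contaminate, integral_add_measure
    ((hρ.integrable_risk α θ s).smul_measure ENNReal.ofReal_ne_top)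
    ((hρ.integrable_risk α θ s).smul_measure ENNReal.ofReal_ne_top),
    integral_smul_measure, integral_smul_measure, ENNReal.toReal_ofReal (by linarith),
    ENNReal.toReal_ofReal hε₀.le]
  rfl

lemma LossCondition.risk_dirac (hρ : LossCondition ρ) (z : Obs p) (α : ℝ) (θ : Reg p) (s : ℝ) :
    risk ρ (Measure.dirac z) α θ s = ρ ((z.1 - α - inner ℝ z.2 θ) / s) :=
  integral_dirac' _ _ (hρ.measurable.comp (measurable_residual α θ s)).stronglyMeasurable

end

/-! ### The risk at the model distribution -/

section

variable {p : ℕ} {ρ : ℝ → ℝ} {F : Measure ℝ} [IsProbabilityMeasure F]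
  {G : Measure (Reg p)} [IsProbabilityMeasure G]

lemma risk_prod (hρ : LossCondition ρ) (α : ℝ) (θ : Reg p) (s : ℝ) :
    risk ρ (F.prod G) α θ s = ∫ x, shiftRisk ρ F s (α + inner ℝ x θ) ∂G := by
  rw [risk, integral_prod_symm _ (hρ.integrable_risk α θ s)]
  simp only [shiftRisk, sub_sub]

lemma integrable_shiftRisk (hρ : LossCondition ρ) (α : ℝ) (θ : Reg p) (s : ℝ) :
    Integrable (fun x => shiftRisk ρ F s (α + inner ℝ x θ)) G := by
  have := (hρ.integrable_risk (H := F.prod G) α θ s).integral_prod_right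
  simpa only [shiftRisk, sub_sub] using this

/-- Given `x`, the residual is the error shifted by `α + x'θ`, and the zero shift is the cheapest.
-/
lemma risk_zero_le (hρ : LossCondition ρ) (h1 : ∃ δ > 0, ρ δ < 1) (hF : ErrorCondition F)
    (α : ℝ) (θ : Reg p) {s : ℝ} (hs : 0 < s) :
    risk ρ (F.prod G) 0 0 s ≤ risk ρ (F.prod G) α θ s := by
  rw [risk_prod hρ, risk_prod hρ]
  refine integral_mono (integrable_shiftRisk hρ 0 0 s) (integrable_shiftRisk hρ α θ s) fun x => ?_
  simp only [inner_zero_right, add_zero]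
  rcases eq_or_ne (α + inner ℝ x θ) 0 with h0 | h0
  · rw [h0]
  · simpa using (shiftRisk_mul_lt hρ h1 hF hs le_rfl one_pos h0).le

/-- The risk strictly increases along rays with nonzero slope. -/
lemma risk_smul_lt (hρ : LossCondition ρ) (h1 : ∃ δ > 0, ρ δ < 1) (hF : ErrorCondition F)
    (hG : RegressorCondition G) (α : ℝ) {θ : Reg p} (hθ : θ ≠ 0) {s : ℝ} (hs : 0 < s) {l : ℝ}
    (hl0 : 0 ≤ l) (hl1 : l < 1) :
    risk ρ (F.prod G) (l * α) (l • θ) s < risk ρ (F.prod G) α θ s := by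
  have e : ∀ x : Reg p, l * α + inner ℝ x (l • θ) = l * (α + inner ℝ x θ) := fun x => by
    rw [inner_smul_right]; ring
  have hi := integrable_shiftRisk (F := F) (G := G) hρ (l * α) (l • θ) s
  rw [risk_prod hρ, risk_prod hρ]
  simp only [e] at hi ⊢
  have hi' := integrable_shiftRisk (F := F) (G := G) hρ α θ s
  rw [← sub_pos, ← integral_sub hi' hi]
  refine (integral_pos_iff_support_of_nonneg ?_ (hi'.sub hi)).2 ?_
  rotate_left
  · have hsub : {x : Reg p | inner ℝ x θ = -α}ᶜ ⊆ Function.support fun x =>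
        shiftRisk ρ F s (α + inner ℝ x θ) - shiftRisk ρ F s (l * (α + inner ℝ x θ)) := by
      intro x hx
      refine (sub_pos.2 (shiftRisk_mul_lt hρ h1 hF hs hl0 hl1 fun h => hx ?_)).ne'
      simp only [mem_ofPred_eq]; linarith
    refine lt_of_lt_of_le ?_ (measure_mono hsub)
    have hm : MeasurableSet {x : Reg p | inner ℝ x θ = -α} :=
      (isClosed_eq (by fun_prop) continuous_const).measurableSet
    rw [prob_compl_eq_one_sub hm, tsub_pos_iff_lt]
    exact hG θ hθ (-α)
  · intro x
    simp only [Pi.zero_apply, Pi.sub_apply, sub_nonneg]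
    rcases eq_or_ne (α + inner ℝ x θ) 0 with h0 | h0
    · rw [h0, mul_zero]
    · exact (shiftRisk_mul_lt hρ h1 hF hs hl0 hl1 h0).le

/-- The fit is halfway along the ray to `(2α, 2θ)`, whose strictly larger risk is at most `1`. -/
lemma risk_lt_one (hρ : LossCondition ρ) (h1 : ∃ δ > 0, ρ δ < 1) (hF : ErrorCondition F)
    (hG : RegressorCondition G) (α : ℝ) {θ : Reg p} (hθ : θ ≠ 0) {s : ℝ} (hs : 0 < s) :
    risk ρ (F.prod G) α θ s < 1 := by
  have h := risk_smul_lt hρ h1 hF hG (2 * α) (θ := (2 : ℝ) • θ) (by simpa using hθ) hs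
    (l := 1 / 2) (by norm_num) (by norm_num)
  rw [smul_smul, ← mul_assoc] at h
  norm_num at h
  exact h.trans_le (hρ.risk_le_one _ _ _)

/-- Residuals at the model avoid any finite set. -/
lemma ae_residual_notMem (hF : ErrorCondition F) {D : Set ℝ} (hD : D.Finite) (α : ℝ) (θ : Reg p)
    {s : ℝ} (hs : 0 < s) :
    ∀ᵐ z ∂F.prod G, (z.1 - α - inner ℝ z.2 θ) / s ∉ D := by
  have hm : MeasurableSet {z : Obs p | (z.1 - α - inner ℝ z.2 θ) / s ∈ D} :=
    measurable_residual α θ s hD.measurableSet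
  rw [ae_iff]
  simp only [not_not]
  rw [Measure.prod_apply_symm hm]
  simp only [lintegral_eq_zero_iff (measurable_measure_prodMk_right hm)]
  refine ae_of_all _ fun x => hF.absolutelyContinuous ?_
  refine Set.Finite.measure_zero (hD.preimage (Function.Injective.injOn fun u v huv => ?_)) _
  have := (div_left_inj' hs.ne').1 huv
  linarith

/-- The risk at the model is jointly continuous in intercept, slope and scale. -/
lemma continuousAt_risk (hρ : LossCondition ρ) (hF : ErrorCondition F) (q : ℝ × Reg p × ℝ)
    (hq : 0 < q.2.2) :
    ContinuousAt (fun q : ℝ × Reg p × ℝ => risk ρ (F.prod G) q.1 q.2.1 q.2.2) q := by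
  refine continuousAt_of_dominated (bound := fun _ => 1) (Eventually.of_forall fun r =>
    (hρ.measurable.comp (measurable_residual r.1 r.2.1 r.2.2)).aestronglyMeasurable)
    (Eventually.of_forall fun r => ae_of_all _ fun z => hρ.abs_le_one _) (integrable_const _) ?_
  filter_upwards [ae_residual_notMem (G := G) hF hρ.finite_discontinuities q.1 q.2.1 hq] with z hz
  refine ContinuousAt.comp (g := ρ) (not_not.1 hz) ?_
  exact ContinuousAt.div (by fun_prop) (by fun_prop) hq.ne'

end

/-! ### The function `m` -/

section

variable {p : ℕ} {ρ : ℝ → ℝ}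

lemma exists_norm_eq_of_pos (hp : 0 < p) {t : ℝ} (ht : 0 ≤ t) : ∃ θ : Reg p, ‖θ‖ = t :=
  ⟨EuclideanSpace.single ⟨0, hp⟩ t, by simp [abs_of_nonneg ht]⟩

lemma m_eq (ρ : ℝ → ℝ) (Ho : Measure (Obs p)) (t s : ℝ) :
    m ρ Ho t s = (⨅ θ : Metric.sphere (0 : Reg p) t, ⨅ α : ℝ, risk ρ Ho α θ s) -
      risk ρ Ho 0 0 s := by
  simp [m, risk]

lemma m_le (hρ : LossCondition ρ) (Ho : Measure (Obs p)) (α : ℝ) {θ : Reg p} {t : ℝ}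
    (hθ : ‖θ‖ = t) (s : ℝ) : m ρ Ho t s ≤ risk ρ Ho α θ s - risk ρ Ho 0 0 s := by
  rw [m_eq]
  refine sub_le_sub_right ?_ _
  have h1 : ∀ θ : Reg p, BddBelow (range fun α => risk ρ Ho α θ s) := fun θ =>
    ⟨0, by rintro _ ⟨α, rfl⟩; exact hρ.risk_nonneg _ _ _ _⟩
  refine (ciInf_le ⟨0, ?_⟩ (⟨θ, by simpa using hθ⟩ : Metric.sphere (0 : Reg p) t)).trans
    (ciInf_le (h1 θ) α)
  rintro _ ⟨θ', rfl⟩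
  exact Real.iInf_nonneg fun α => hρ.risk_nonneg _ _ _ _

lemma le_m (hp : 0 < p) (Ho : Measure (Obs p)) {t : ℝ} (ht : 0 ≤ t) {s c : ℝ}
    (h : ∀ (α : ℝ) (θ : Reg p), ‖θ‖ = t → c ≤ risk ρ Ho α θ s) :
    c - risk ρ Ho 0 0 s ≤ m ρ Ho t s := by
  rw [m_eq]
  refine sub_le_sub_right ?_ _
  obtain ⟨θ, hθ⟩ := exists_norm_eq_of_pos hp ht
  -- Over an empty sphere the infimum would default to `0`; this is where `0 < p` enters.
  have : Nonempty (Metric.sphere (0 : Reg p) t) := ⟨θ, by simpa using hθ⟩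
  exact le_ciInf fun θ' => le_ciInf fun α => h α θ' (by simp)

lemma exists_of_m_lt (hp : 0 < p) (Ho : Measure (Obs p)) {t : ℝ} (ht : 0 ≤ t) {s v : ℝ}
    (h : m ρ Ho t s < v) : ∃ (α : ℝ) (θ : Reg p), ‖θ‖ = t ∧
      risk ρ Ho α θ s - risk ρ Ho 0 0 s < v := by
  by_contra! hcon
  have := le_m (ρ := ρ) (s := s) (c := v + risk ρ Ho 0 0 s) hp Ho ht
    fun α θ hθ => by linarith [hcon α θ hθ]
  linarith

lemma neg_one_le_m (hρ : LossCondition ρ) (Ho : Measure (Obs p)) [IsProbabilityMeasure Ho]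
    (t s : ℝ) : -1 ≤ m ρ Ho t s := by
  rw [m_eq]
  have h1 : 0 ≤ ⨅ θ : Metric.sphere (0 : Reg p) t, ⨅ α : ℝ, risk ρ Ho α θ s :=
    Real.iInf_nonneg fun θ => Real.iInf_nonneg fun α => hρ.risk_nonneg _ _ _ _
  have h2 := hρ.risk_le_one (H := Ho) 0 0 s
  linarith

variable {F : Measure ℝ} [IsProbabilityMeasure F] {G : Measure (Reg p)} [IsProbabilityMeasure G]

/-- Strictness comes from attainment. Some fit with slope norm `t'` has risk below `1`, so
intercepts can be confined to a compact interval and a minimizer exists; shrinking it by `t / t'`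
strictly lowers the risk. -/
lemma m_strictMonoOn (hp : 0 < p) (hρ : LossCondition ρ) (h1 : ∃ δ > 0, ρ δ < 1)
    (hF : ErrorCondition F) (hG : RegressorCondition G) {s : ℝ} (hs : 0 < s) :
    StrictMonoOn (fun t => m ρ (F.prod G) t s) (Ici 0) := by
  intro t ht t' _ htt
  have ht0 : 0 ≤ t := ht
  have ht' : 0 < t' := ht0.trans_lt htt
  obtain ⟨θ₁, hθ₁⟩ := exists_norm_eq_of_pos hp ht'.le
  have hne : ∀ θ : Reg p, ‖θ‖ = t' → θ ≠ 0 := fun θ hθ h0 => by simp [h0] at hθ; linarith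
  have hR1 := risk_lt_one (ρ := ρ) hρ h1 hF hG 0 (hne θ₁ hθ₁) hs
  obtain ⟨A, hA0, hA⟩ := hρ.exists_intercept_bound (F.prod G) hR1 hs t'
  have hcont : ContinuousOn (fun q : ℝ × Reg p => risk ρ (F.prod G) q.1 q.2 s)
      (Icc (-A) A ×ˢ Metric.sphere 0 t') := fun q _ =>
    (ContinuousAt.comp (f := fun q : ℝ × Reg p => (q.1, q.2, s))
      (continuousAt_risk hρ hF (q.1, q.2, s) hs) (by fun_prop)).continuousWithinAt
  obtain ⟨q, hq, hmin⟩ := (isCompact_Icc.prod (isCompact_sphere (0 : Reg p) t')).exists_isMinOn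
    ⟨(0, θ₁), ⟨⟨by simpa using hA0, hA0⟩, by simpa using hθ₁⟩⟩ hcont
  have hqt : ‖q.2‖ = t' := by simpa using hq.2
  have hle : ∀ (α : ℝ) (θ : Reg p), ‖θ‖ = t' →
      risk ρ (F.prod G) q.1 q.2 s ≤ risk ρ (F.prod G) α θ s := by
    intro α θ hθ
    rcases le_total A |α| with hα | hα
    · refine le_trans ?_ (hA α θ s hα hθ.le hs le_rfl).le
      exact hmin (a := (0, θ₁)) ⟨⟨by simpa using hA0, hA0⟩, by simpa using hθ₁⟩
    · exact hmin (a := (α, θ)) ⟨abs_le.1 hα, by simpa using hθ⟩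
  have hlt := risk_smul_lt hρ h1 hF hG q.1 (hne _ hqt) hs (l := t / t')
    (by positivity) ((div_lt_one ht').2 htt)
  have hmt : m ρ (F.prod G) t s ≤ risk ρ (F.prod G) (t / t' * q.1) ((t / t') • q.2) s -
      risk ρ (F.prod G) 0 0 s := m_le hρ _ _ (by
    rw [norm_smul, hqt, Real.norm_of_nonneg (by positivity)]; field_simp) s
  have hmt' := le_m hp (F.prod G) ht'.le hle
  simp only
  linarith

end

/-! ### Scales and functionals -/

section

variable {p : ℕ} {ρ : ℝ → ℝ} {b : ℝ} {H : Measure (Obs p)}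

lemma bddBelow_feasible (ρ : ℝ → ℝ) (b : ℝ) (H : Measure (Obs p)) :
    BddBelow {σ | 0 < σ ∧ ∃ (α : ℝ) (θ : Reg p), risk ρ H α θ σ ≤ b} :=
  ⟨0, fun _ h => h.1.le⟩

lemma sScale_le {α : ℝ} {θ : Reg p} {σ : ℝ} (hσ : 0 < σ) (h : risk ρ H α θ σ ≤ b) :
    sScale ρ b H ≤ σ :=
  csInf_le (bddBelow_feasible ρ b H) ⟨hσ, α, θ, h⟩

lemma IsSSolution.sScale_eq {α : ℝ} {θ : Reg p} {σ : ℝ} (h : IsSSolution ρ b H α θ σ) :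
    sScale ρ b H = σ := by
  obtain ⟨-, hglb, hle⟩ := h
  have : IsGLB {σ | 0 < σ ∧ ∃ (α : ℝ) (θ : Reg p), risk ρ H α θ σ ≤ b} σ :=
    ⟨fun σ' ⟨h0, α', θ', h'⟩ => hle α' θ' σ' h0 h',
      fun c hc => hglb.2 fun σ' ⟨h0, h'⟩ => hc ⟨h0, α, θ, h'⟩⟩
  obtain ⟨x, hx⟩ : {σ | 0 < σ ∧ ∃ (α : ℝ) (θ : Reg p), risk ρ H α θ σ ≤ b}.Nonempty := this.nonempty
  exact this.csInf_eq ⟨x, hx⟩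

lemma exists_eq_some_of_maxBias_le {T : SlopeFunctional p} {Ho : Measure (Obs p)} {ε B : ℝ}
    (hB : 0 ≤ B) (h : maxBias T Ho ε ≤ ENNReal.ofReal B) (hH : H ∈ neighborhood Ho ε) :
    ∃ θ, T H = some θ ∧ ‖θ‖ ≤ B := by
  have hle : bias T H ≤ ENNReal.ofReal B := (le_iSup₂ (f := fun H _ => bias T H) H hH).trans h
  rcases hT : T H with _ | θ
  · simp [bias, hT] at hle
  · refine ⟨θ, rfl, (ENNReal.ofReal_le_ofReal_iff hB).1 ?_⟩
    simpa [bias, hT] using hle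

lemma contaminate_mem_neighborhood (Ho H' : Measure (Obs p)) [IsProbabilityMeasure H'] (ε : ℝ) :
    contaminate Ho H' ε ∈ neighborhood Ho ε := ⟨H', inferInstance, rfl⟩

end

/-! ### Contamination by a single outlier -/

section

variable {p : ℕ} {ρ : ℝ → ℝ} {Ho : Measure (Obs p)} [IsProbabilityMeasure Ho] {b ε B : ℝ}

/-- A leverage point fitted exactly by intercept `α` and slope `θ`. -/
noncomputable def outlier (α : ℝ) (θ : Reg p) (n : ℕ) : Obs p := (n * ‖θ‖ ^ 2 + α, (n : ℝ) • θ)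

lemma risk_outlier_self (hρ : LossCondition ρ) (α : ℝ) (θ : Reg p) (n : ℕ) (s : ℝ) :
    risk ρ (Measure.dirac (outlier α θ n)) α θ s = 0 := by
  rw [hρ.risk_dirac]
  simp [outlier, real_inner_smul_left, hρ.zero]

/-- Fits whose slope is shorter than the one fitting a remote outlier either have a huge intercept,
or pay for nearly all of the contamination. -/
lemma eventually_lt_risk_contaminate (hρ : LossCondition ρ) (hε₀ : 0 < ε) (hε₁ : ε < 1)
    (hmin : ∀ (α : ℝ) (θ : Reg p) (s : ℝ), 0 < s → risk ρ Ho 0 0 s ≤ risk ρ Ho α θ s)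
    (hB : 0 ≤ B) (α₀ : ℝ) {θ₀ : Reg p} (hθ₀ : B < ‖θ₀‖) {S : ℝ} (hS : 0 < S) {c₁ c₂ : ℝ}
    (hc₁ : c₁ < 1 - ε) (hc₂ : c₂ < ε) :
    ∀ᶠ n : ℕ in atTop, ∀ (α : ℝ) (θ : Reg p) (s : ℝ), ‖θ‖ ≤ B → 0 < s → s ≤ S →
      c₁ < risk ρ (contaminate Ho (Measure.dirac (outlier α₀ θ₀ n)) ε) α θ s ∨
      (1 - ε) * risk ρ Ho 0 0 s + c₂ <
        risk ρ (contaminate Ho (Measure.dirac (outlier α₀ θ₀ n)) ε) α θ s := by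
  have hε' : 0 < 1 - ε := by linarith
  obtain ⟨A, hA0, hA⟩ := hρ.exists_intercept_bound Ho (c := c₁ / (1 - ε))
    ((div_lt_one hε').2 hc₁) hS B
  have hθpos : 0 < ‖θ₀‖ := hB.trans_lt hθ₀
  -- By Cauchy–Schwarz this bounds below the residual of the outlier from any fit with `|α| ≤ A` and
  -- `‖θ‖ ≤ B`.
  have hr : Tendsto (fun n : ℕ => (n : ℝ) * (‖θ₀‖ * (‖θ₀‖ - B)) + (-|α₀| - A)) atTop atTop :=
    tendsto_atTop_add_const_right _ _ (tendsto_natCast_atTop_atTop.atTop_mul_const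
      (mul_pos hθpos (by linarith)))
  have hρlim := hρ.limit.comp (hr.atTop_div_const hS)
  filter_upwards [hρlim.eventually_const_lt ((div_lt_one hε₀).2 hc₂), hr.eventually_ge_atTop 0]
    with n hn hn0 α θ s hθ hs hsS
  rw [hρ.risk_contaminate hε₀ hε₁, hρ.risk_dirac]
  rcases le_total A |α| with hα | hα
  · left
    have h1 := (div_lt_iff₀' hε').1 (hA α θ s hα hθ hs hsS)
    have h2 := mul_nonneg hε₀.le
      (hρ.nonneg (((outlier α₀ θ₀ n).1 - α - inner ℝ (outlier α₀ θ₀ n).2 θ) / s))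
    linarith
  · right
    have h1 := mul_le_mul_of_nonneg_left (hmin α θ s hs) hε'.le
    rw [Function.comp_apply, div_lt_iff₀' hε₀] at hn
    have hin : inner ℝ θ₀ θ ≤ ‖θ₀‖ * B :=
      (real_inner_le_norm _ _).trans (mul_le_mul_of_nonneg_left hθ hθpos.le)
    have hres : (n : ℝ) * (‖θ₀‖ * (‖θ₀‖ - B)) + (-|α₀| - A) ≤
        (outlier α₀ θ₀ n).1 - α - inner ℝ (outlier α₀ θ₀ n).2 θ := by
      simp only [outlier, real_inner_smul_left]
      have h2 := mul_le_mul_of_nonneg_left hin (Nat.cast_nonneg (α := ℝ) n)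
      have h3 := neg_abs_le α₀
      have h4 := (le_abs_self α).trans hα
      nlinarith
    have h2 : ρ (((n : ℝ) * (‖θ₀‖ * (‖θ₀‖ - B)) + (-|α₀| - A)) / S) ≤
        ρ (((outlier α₀ θ₀ n).1 - α - inner ℝ (outlier α₀ θ₀ n).2 θ) / s) := by
      refine hρ.le_of_abs_le ?_
      rw [abs_div, abs_div, abs_of_pos hs, abs_of_pos hS, abs_of_nonneg hn0,
        abs_of_nonneg (hn0.trans hres)]
      gcongr
      exact hn0.trans hres
    have h3 := mul_le_mul_of_nonneg_left h2 hε₀.le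
    linarith

/-- A bounded S-estimate has scale at least `σ` under remote contamination, if `σ` is too small a
scale for the true parameters with all of the contamination sent to infinity. -/
lemma eventually_le_sScale (hρ : LossCondition ρ) (hε₀ : 0 < ε) (hε₁ : ε < 1)
    (hmin : ∀ (α : ℝ) (θ : Reg p) (s : ℝ), 0 < s → risk ρ Ho 0 0 s ≤ risk ρ Ho α θ s)
    (hB : 0 ≤ B)
    (hsol : ∀ H ∈ neighborhood Ho ε, ∃ α θ, ‖θ‖ ≤ B ∧ IsSSolution ρ b H α θ (sScale ρ b H))
    (hb : b < 1 - ε) (α₀ : ℝ) {θ₀ : Reg p} (hθ₀ : B < ‖θ₀‖) {σ : ℝ} (hσ : 0 < σ)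
    (h : b < (1 - ε) * risk ρ Ho 0 0 σ + ε) :
    ∀ᶠ n : ℕ in atTop, σ ≤ sScale ρ b (contaminate Ho (Measure.dirac (outlier α₀ θ₀ n)) ε) := by
  -- With `c₁ = b` and this `c₂`, both alternatives say that the risk at `σ` exceeds `b`.
  filter_upwards [eventually_lt_risk_contaminate hρ hε₀ hε₁ hmin hB α₀ hθ₀ hσ hb
    (c₂ := b - (1 - ε) * risk ρ Ho 0 0 σ) (by linarith)] with n hn
  by_contra! hlt
  have := isProbabilityMeasure_contaminate (Ho := Ho) hε₀ hε₁ (Measure.dirac (outlier α₀ θ₀ n))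
  obtain ⟨α, θ, hθ, -, hglb, -⟩ := hsol _
    (contaminate_mem_neighborhood Ho (Measure.dirac (outlier α₀ θ₀ n)) ε)
  -- The constraint may fail at the M-scale itself, so a feasible scale just above it and below `σ`
  -- is used.
  obtain ⟨σ', ⟨hσ', hr⟩, -, hσσ⟩ := hglb.exists_between hlt
  have hr' := (hρ.risk_anti α θ hσ' hσσ.le).trans hr
  rcases hn α θ σ hθ hσ le_rfl with h1 | h1 <;> linarith

/-- With all contamination at the origin, zero parameters have risk at most `1 - ε` at every scale.
If `1 - ε ≤ b`, every scale is feasible and no positive one is least. -/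
lemma lt_one_sub_of_exists_isSSolution (hρ : LossCondition ρ) (hε₀ : 0 < ε) (hε₁ : ε < 1)
    (hsol : ∀ H ∈ neighborhood Ho ε, ∃ α θ σ, IsSSolution ρ b H α θ σ) : b < 1 - ε := by
  by_contra! hb
  obtain ⟨α, θ, σ, hσ, -, hle⟩ := hsol _
    (contaminate_mem_neighborhood Ho (Measure.dirac (outlier 0 0 0)) ε)
  have := hle 0 0 (σ / 2) (by linarith) (by
    rw [hρ.risk_contaminate hε₀ hε₁, risk_outlier_self hρ]
    have := hρ.risk_le_one (H := Ho) 0 0 (σ / 2)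
    nlinarith)
  linarith

end

/-! ### The constant `b = E ρ(u)` -/

section

variable {p : ℕ} {ρ : ℝ → ℝ} {F : Measure ℝ} [IsProbabilityMeasure F]

lemma integral_loss_pos (hρ : LossCondition ρ) (hF : ErrorCondition F) : 0 < ∫ u, ρ u ∂F := by
  refine (integral_pos_iff_support_of_nonneg hρ.nonneg (hρ.integrable_comp measurable_id)).2 ?_
  obtain ⟨M, hM⟩ := ((hρ.limit.eventually_const_lt one_pos).and (eventually_ge_atTop 0)).exists
  have hsub : Ioi M ⊆ Function.support ρ := fun u hu =>
    (hM.1.trans_le (hρ.mono hM.2 (hM.2.trans (le_of_lt hu)) (le_of_lt hu))).ne'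
  refine lt_of_lt_of_le ?_ (measure_mono hsub)
  refine pos_iff_ne_zero.2 fun h0 => ?_
  simpa using hF.volume_absolutelyContinuous h0

lemma le_integral_loss (hρ : LossCondition ρ) (hF : ErrorCondition F) {c : ℝ}
    (h : ∀ u > 0, c ≤ ρ u) : c ≤ ∫ u, ρ u ∂F := by
  have : ∫ _, c ∂F ≤ ∫ u, ρ u ∂F := by
    refine integral_mono_ae (integrable_const _) (hρ.integrable_comp measurable_id) ?_
    filter_upwards [hF.ae_ne 0] with u hu
    rw [← hρ.map_abs]
    exact h _ (abs_pos.2 hu)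
  simpa using this

/-- The risk of any fit is eventually below a multiple `> 1` of `b`, as the scale grows. -/
lemma exists_risk_le (hρ : LossCondition ρ) (hF : ErrorCondition F) (G : Measure (Reg p))
    [IsProbabilityMeasure G] (α : ℝ) (θ : Reg p) {ε : ℝ} (hε₀ : 0 < ε) (hε₁ : ε < 1) :
    ∃ σ > 0, (1 - ε) * risk ρ (F.prod G) α θ σ ≤ ∫ u, ρ u ∂F := by
  -- The right limit of the loss at `0`, possibly positive. Residuals are a.s. nonzero, so the risk
  -- tends to `j ≤ b`; the factor `1 - ε` leaves room even if `j = b`.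
  set j := sInf (ρ '' Ioi 0) with hj
  have hbdd : BddBelow (ρ '' Ioi 0) := ⟨0, by rintro _ ⟨u, -, rfl⟩; exact hρ.nonneg u⟩
  have hjlim : Tendsto ρ (𝓝[>] 0) (𝓝 j) :=
    (hρ.mono.mono Ioi_subset_Ici_self).tendsto_nhdsGT hbdd
  have hjb : j ≤ ∫ u, ρ u ∂F := le_integral_loss hρ hF fun u hu => csInf_le hbdd ⟨u, hu, rfl⟩
  have hlim : Tendsto (fun σ => risk ρ (F.prod G) α θ σ) atTop (𝓝 (∫ _, j ∂(F.prod G))) := by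
    refine tendsto_integral_filter_of_dominated_convergence (fun _ => 1)
      (Eventually.of_forall fun σ =>
        (hρ.measurable.comp (measurable_residual α θ σ)).aestronglyMeasurable)
      (Eventually.of_forall fun σ => ae_of_all _ fun z => hρ.abs_le_one _) (integrable_const _) ?_
    filter_upwards [ae_residual_notMem (G := G) hF (finite_singleton 0) α θ one_pos] with z hz
    rw [mem_singleton_iff, div_one] at hz
    have h0 : Tendsto (fun σ => |z.1 - α - inner ℝ z.2 θ| / σ) atTop (𝓝[>] 0) := by
      refine tendsto_nhdsWithin_iff.2 ⟨tendsto_const_nhds.div_atTop tendsto_id, ?_⟩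
      filter_upwards [eventually_gt_atTop 0] with σ hσ
      exact div_pos (abs_pos.2 hz) hσ
    refine (hjlim.comp h0).congr' ?_
    filter_upwards [eventually_gt_atTop 0] with σ hσ
    rw [Function.comp_apply, ← hρ.map_abs ((z.1 - α - inner ℝ z.2 θ) / σ), abs_div, abs_of_pos hσ]
  simp only [integral_const, probReal_univ, smul_eq_mul, one_mul] at hlim
  have hb := integral_loss_pos hρ hF
  have hlt : (1 - ε) * j < ∫ u, ρ u ∂F := by nlinarith
  obtain ⟨σ, h1, h2⟩ := (((hlim.const_mul (1 - ε)).eventually_lt_const hlt).and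
    (eventually_gt_atTop 0)).exists
  exact ⟨σ, h2, h1.le⟩

lemma exists_loss_lt_one (hρ : LossCondition ρ) (hF : ErrorCondition F) (h : ∫ u, ρ u ∂F < 1) :
    ∃ δ > 0, ρ δ < 1 := by
  by_contra! hcon
  exact absurd (le_integral_loss hρ hF hcon) (not_le.2 h)

end

/-! ### Existence of minimizers, and the bounds on the maximum bias -/

section

variable {p : ℕ} {ρ : ℝ → ℝ} {F : Measure ℝ} [IsProbabilityMeasure F]
  {G : Measure (Reg p)} [IsProbabilityMeasure G] {ε : ℝ}

/-- No fit at a contaminated distribution beats the true parameters if its slope is longer than a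
`t` with `m(t, s) ≥ ε / (1 - ε)`. -/
lemma risk_zero_lt_of_lt_norm (hp : 0 < p) (hρ : LossCondition ρ) (h1 : ∃ δ > 0, ρ δ < 1)
    (hF : ErrorCondition F) (hG : RegressorCondition G) (hε₀ : 0 < ε) (hε₁ : ε < 1) {s t : ℝ}
    (hs : 0 < s) (ht : 0 ≤ t) (htv : ε / (1 - ε) ≤ m ρ (F.prod G) t s) (H' : Measure (Obs p))
    [IsProbabilityMeasure H'] (α : ℝ) {θ : Reg p} (hθ : t < ‖θ‖) :
    risk ρ (contaminate (F.prod G) H' ε) 0 0 s < risk ρ (contaminate (F.prod G) H' ε) α θ s := by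
  have h2 : m ρ (F.prod G) t s < m ρ (F.prod G) ‖θ‖ s :=
    m_strictMonoOn hp hρ h1 hF hG hs ht (ht.trans hθ.le) hθ
  have h3 := m_le hρ (F.prod G) α (rfl : ‖θ‖ = ‖θ‖) s
  have h4 := (div_lt_iff₀' (by linarith : 0 < 1 - ε)).1 (htv.trans_lt (h2.trans_le h3))
  rw [hρ.risk_contaminate hε₀ hε₁, hρ.risk_contaminate hε₀ hε₁]
  have h5 := mul_le_mul_of_nonneg_left (hρ.risk_le_one (H := H') 0 0 s) hε₀.le
  have h6 := mul_nonneg hε₀.le (hρ.risk_nonneg H' α θ s)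
  linarith

/-- Long slopes and huge intercepts both lose to the true parameters, so a lower semicontinuous risk
need only be minimized over a compact set. -/
lemma exists_forall_risk_le (hp : 0 < p) (hρ : LossCondition ρ) (h1 : ∃ δ > 0, ρ δ < 1)
    (hl : LowerSemicontinuous ρ) (hF : ErrorCondition F) (hG : RegressorCondition G)
    (hε₀ : 0 < ε) (hε₁ : ε < 1) {s t : ℝ} (hs : 0 < s) (ht : 0 ≤ t)
    (htv : ε / (1 - ε) ≤ m ρ (F.prod G) t s) (H' : Measure (Obs p)) [IsProbabilityMeasure H'] :
    ∃ (α : ℝ) (θ : Reg p), ∀ (α' : ℝ) (θ' : Reg p),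
      risk ρ (contaminate (F.prod G) H' ε) α θ s ≤
        risk ρ (contaminate (F.prod G) H' ε) α' θ' s := by
  have := isProbabilityMeasure_contaminate (Ho := F.prod G) hε₀ hε₁ H'
  have hε' : 0 < 1 - ε := by linarith
  -- Going beyond `t` makes `m` exceed `ε / (1 - ε)` strictly, which gives the gap below `1` in
  -- `h5`.
  obtain ⟨θ₁, hθ₁⟩ := exists_norm_eq_of_pos hp (by linarith : 0 ≤ t + 1)
  have h2 : m ρ (F.prod G) t s < m ρ (F.prod G) (t + 1) s :=
    m_strictMonoOn hp hρ h1 hF hG hs ht (show 0 ≤ t + 1 by linarith) (lt_add_one t)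
  have h3 := m_le hρ (F.prod G) 0 hθ₁ s
  have h4 := hρ.risk_le_one (H := F.prod G) 0 θ₁ s
  have h5 : ε / (1 - ε) + risk ρ (F.prod G) 0 0 s < 1 := by linarith
  obtain ⟨A, hA0, hA⟩ := hρ.exists_intercept_bound (F.prod G) h5 hs t
  have hmem : ((0 : ℝ), (0 : Reg p)) ∈ Icc (-A) A ×ˢ Metric.closedBall (0 : Reg p) t :=
    ⟨⟨by simpa using hA0, hA0⟩, by simpa using ht⟩
  obtain ⟨q, -, hq⟩ := LowerSemicontinuousOn.exists_isMinOn ⟨_, hmem⟩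
    (isCompact_Icc.prod (isCompact_closedBall (0 : Reg p) t))
    ((hρ.lowerSemicontinuous_risk (H := contaminate (F.prod G) H' ε) hl s).lowerSemicontinuousOn _)
  have hq0 : risk ρ (contaminate (F.prod G) H' ε) q.1 q.2 s ≤
      risk ρ (contaminate (F.prod G) H' ε) 0 0 s := hq hmem
  refine ⟨q.1, q.2, fun α θ => ?_⟩
  rcases lt_or_ge t ‖θ‖ with hθ | hθ
  · exact hq0.trans (risk_zero_lt_of_lt_norm hp hρ h1 hF hG hε₀ hε₁ hs ht htv H' α hθ).le
  rcases le_total A |α| with hα | hα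
  · refine hq0.trans ?_
    have h6 := hA α θ s hα hθ hs le_rfl
    rw [hρ.risk_contaminate hε₀ hε₁, hρ.risk_contaminate hε₀ hε₁]
    have h7 := mul_le_mul_of_nonneg_left (hρ.risk_le_one (H := H') 0 0 s) hε₀.le
    have h8 := mul_nonneg hε₀.le (hρ.risk_nonneg H' α θ s)
    have h9 : ε / (1 - ε) < risk ρ (F.prod G) α θ s - risk ρ (F.prod G) 0 0 s := by linarith
    rw [div_lt_iff₀' hε'] at h9
    linarith
  · exact hq (a := (α, θ)) ⟨abs_le.1 hα, by simpa using hθ⟩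

/-- If the S-estimate is bounded over the neighbourhood, then so is the scale. -/
lemma bddAbove_sScale (hp : 0 < p) (hρ : LossCondition ρ) (h1 : ∃ δ > 0, ρ δ < 1)
    (hF : ErrorCondition F) (hε₀ : 0 < ε) (hε₁ : ε < 1) {b B : ℝ} (hb : b = ∫ u, ρ u ∂F)
    (hbε : b < 1 - ε) (hB : 0 ≤ B)
    (hsol : ∀ H ∈ neighborhood (F.prod G) ε,
      ∃ α θ, ‖θ‖ ≤ B ∧ IsSSolution ρ b H α θ (sScale ρ b H)) :
    BddAbove (sScale ρ b '' neighborhood (F.prod G) ε) := by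
  obtain ⟨θ₀, hθ₀⟩ := exists_norm_eq_of_pos hp (by linarith : 0 ≤ B + 1)
  obtain ⟨σ, hσ, hr⟩ := exists_risk_le hρ hF G 0 θ₀ hε₀ hε₁
  -- Otherwise remote outliers fitted by `(0, θ₀)` would force the scale up to `2 * σ`, although
  -- `(0, θ₀)` is feasible at `σ`. This inequality makes `2 * σ` feasible for the true parameters at
  -- every contamination.
  have hle : (1 - ε) * risk ρ (F.prod G) 0 0 (2 * σ) + ε ≤ b := by
    by_contra! hcon
    obtain ⟨n, hn⟩ := (eventually_le_sScale hρ hε₀ hε₁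
      (fun α θ s hs => risk_zero_le hρ h1 hF α θ hs) hB hsol hbε 0
      (by linarith : B < ‖θ₀‖) (by linarith : 0 < 2 * σ) hcon).exists
    have : sScale ρ b (contaminate (F.prod G) (Measure.dirac (outlier 0 θ₀ n)) ε) ≤ σ := by
      refine sScale_le (α := 0) (θ := θ₀) hσ ?_
      rw [hρ.risk_contaminate hε₀ hε₁, risk_outlier_self hρ]
      linarith
    linarith
  refine ⟨2 * σ, ?_⟩
  rintro _ ⟨_, ⟨H', hH', rfl⟩, rfl⟩
  refine sScale_le (α := 0) (θ := 0) (by linarith) ?_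
  change risk ρ (contaminate (F.prod G) H' ε) _ _ _ ≤ _
  rw [hρ.risk_contaminate hε₀ hε₁]
  have := mul_le_mul_of_nonneg_left (hρ.risk_le_one (H := H') 0 0 (2 * σ)) hε₀.le
  linarith

/-- Under remote contamination fitted by a slope beyond the range of the S-estimate, the scale
tends to its supremum over the neighbourhood. -/
lemma tendsto_sScale_sUpper (hρ : LossCondition ρ) (h1 : ∃ δ > 0, ρ δ < 1)
    (hF : ErrorCondition F) (hε₀ : 0 < ε) (hε₁ : ε < 1) {b B : ℝ}
    (hbε : b < 1 - ε) (hB : 0 ≤ B)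
    (hsol : ∀ H ∈ neighborhood (F.prod G) ε,
      ∃ α θ, ‖θ‖ ≤ B ∧ IsSSolution ρ b H α θ (sScale ρ b H))
    (hbdd : BddAbove (sScale ρ b '' neighborhood (F.prod G) ε))
    (hpos : 0 < sUpper ρ b (F.prod G) ε) (α₀ : ℝ) {θ₀ : Reg p} (hθ₀ : B < ‖θ₀‖) :
    Tendsto (fun n => sScale ρ b (contaminate (F.prod G) (Measure.dirac (outlier α₀ θ₀ n)) ε))
      atTop (𝓝 (sUpper ρ b (F.prod G) ε)) := by
  have hmem := fun n => contaminate_mem_neighborhood (F.prod G) (Measure.dirac (outlier α₀ θ₀ n)) ε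
  refine tendsto_order.2 ⟨fun a ha => ?_, fun a ha => Eventually.of_forall fun n =>
    (le_csSup hbdd ⟨_, hmem n, rfl⟩).trans_lt ha⟩
  obtain ⟨σ, hσ, hσs⟩ := exists_between (max_lt ha hpos)
  have hσ0 := (le_max_right _ _).trans_lt hσ
  -- Otherwise `σ` would be feasible for the true parameters throughout the neighbourhood, bounding
  -- `s̄` by `σ`.
  have hlt : b < (1 - ε) * risk ρ (F.prod G) 0 0 σ + ε := by
    by_contra! hcon
    refine absurd (csSup_le ⟨_, ⟨_, hmem 0, rfl⟩⟩ ?_ : sUpper ρ b (F.prod G) ε ≤ σ) (not_le.2 hσs)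
    rintro _ ⟨_, ⟨H', hH', rfl⟩, rfl⟩
    refine sScale_le (α := 0) (θ := 0) hσ0 ?_
    change risk ρ (contaminate (F.prod G) H' ε) _ _ _ ≤ _
    rw [hρ.risk_contaminate hε₀ hε₁]
    have := mul_le_mul_of_nonneg_left (hρ.risk_le_one (H := H') 0 0 σ) hε₀.le
    linarith
  filter_upwards [eventually_le_sScale hρ hε₀ hε₁
    (fun α θ s hs => risk_zero_le hρ h1 hF α θ hs) hB hsol hbε α₀ hθ₀ hσ0 hlt] with n hn
  exact ((le_max_left _ _).trans_lt hσ).trans_le hn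

lemma continuousAt_risk_scale (hρ : LossCondition ρ) (hF : ErrorCondition F) (α : ℝ) (θ : Reg p)
    {s : ℝ} (hs : 0 < s) : ContinuousAt (fun s => risk ρ (F.prod G) α θ s) s :=
  ContinuousAt.comp (f := fun s => (α, θ, s)) (continuousAt_risk hρ hF (α, θ, s) hs) (by fun_prop)

/-- If both estimates have slopes of norm at most `B < t`, then `m(t, s̄) ≥ ε / (1 - ε)`. -/
lemma le_m_sUpper {ρ₁ ρ₂ : ℝ → ℝ} (hp : 0 < p) (hρ₁ : LossCondition ρ₁) (h1 : ∃ δ > 0, ρ₁ δ < 1)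
    (hρ₂ : LossCondition ρ₂) (h2 : ∃ δ > 0, ρ₂ δ < 1) (hF : ErrorCondition F)
    (hG : RegressorCondition G) (hε₀ : 0 < ε) (hε₁ : ε < 1) {b B t : ℝ} (hbε : b < 1 - ε)
    (hB : 0 ≤ B)
    (hsol : ∀ H ∈ neighborhood (F.prod G) ε,
      ∃ α θ, ‖θ‖ ≤ B ∧ IsSSolution ρ₁ b H α θ (sScale ρ₁ b H))
    (hbdd : BddAbove (sScale ρ₁ b '' neighborhood (F.prod G) ε))
    (hMM : ∀ H ∈ neighborhood (F.prod G) ε, ∃ α θ, ‖θ‖ ≤ B ∧ IsMMSolution ρ₁ ρ₂ b H α θ)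
    (hBt : B < t) : ε / (1 - ε) ≤ m ρ₂ (F.prod G) t (sUpper ρ₁ b (F.prod G) ε) := by
  by_contra! hlt
  have hε' : 0 < 1 - ε := by linarith
  have ht : 0 < t := hB.trans_lt hBt
  obtain ⟨α₀, θ₀, hθ₀, hv⟩ := exists_of_m_lt hp (F.prod G) ht.le hlt
  set s := sUpper ρ₁ b (F.prod G) ε with hs
  have hmem := fun n => contaminate_mem_neighborhood (F.prod G) (Measure.dirac (outlier α₀ θ₀ n)) ε
  have hle := fun n => le_csSup hbdd ⟨_, hmem n, rfl⟩
  have hpos : 0 < s := by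
    obtain ⟨_, _, _, h, -⟩ := hsol _ (hmem 0)
    exact h.trans_le (hle 0)
  have hlim := tendsto_sScale_sUpper hρ₁ h1 hF hε₀ hε₁ hbε hB hsol hbdd hpos α₀
    (by rwa [hθ₀] : B < ‖θ₀‖)
  have hl₀ := ((continuousAt_risk_scale (G := G) hρ₂ hF α₀ θ₀ hpos).tendsto.comp hlim).const_mul
    (1 - ε)
  have hl := hl₀.sub (((continuousAt_risk_scale (G := G) hρ₂ hF 0 0 hpos).tendsto.comp
    hlim).const_mul (1 - ε))
  have hθ0 : θ₀ ≠ 0 := fun h0 => by simp [h0] at hθ₀; linarith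
  -- Only the limit `s̄` of the scales is known. The levels `c₁` and `c₂` leave slack in both strict
  -- inequalities at `s̄`, so that they persist at the scale for large `n`.
  obtain ⟨c₁, hc₁, hc₁'⟩ := exists_between (show (1 - ε) * risk ρ₂ (F.prod G) α₀ θ₀ s < 1 - ε by
    nlinarith [risk_lt_one hρ₂ h2 hF hG α₀ hθ0 hpos])
  rw [lt_div_iff₀' hε', mul_sub] at hv
  obtain ⟨c₂, hc₂, hc₂'⟩ := exists_between hv
  obtain ⟨n, hn, hn₁, hn₂⟩ := ((eventually_lt_risk_contaminate hρ₂ hε₀ hε₁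
    (fun α θ s hs => risk_zero_le (G := G) hρ₂ h2 hF α θ hs) hB α₀ (by rwa [hθ₀] : B < ‖θ₀‖) hpos
    hc₁' hc₂').and ((hl₀.eventually_lt_const hc₁).and (hl.eventually_lt_const hc₂))).exists
  obtain ⟨α, θ, hθ, hsn, hmin⟩ := hMM _ (hmem n)
  have h3 := hmin α₀ θ₀
  rw [hρ₂.risk_contaminate hε₀ hε₁ _ α₀, risk_outlier_self hρ₂] at h3
  simp only [Function.comp_apply] at hn₁ hn₂
  rcases hn α θ _ hθ hsn (hle n) with h4 | h4 <;> linarith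

end

end MMBias

theorem theorem3p1 {p : ℕ} (hp : 0 < p)
    (F : Measure ℝ) [IsProbabilityMeasure F] (hF : MMBias.ErrorCondition F)
    (G : Measure (MMBias.Reg p)) [IsProbabilityMeasure G] (hG : MMBias.RegressorCondition G)
    (Ho : Measure (MMBias.Obs p)) (hHo : Ho = MMBias.modelLaw F G)
    (ρ₁ ρ₂ : ℝ → ℝ) (hρ₁ : MMBias.LossCondition ρ₁) (hρ₂ : MMBias.LossCondition ρ₂)
    (hρ : ∀ u, ρ₂ u ≤ ρ₁ u)
    (b : ℝ) (hb : b = ∫ u, ρ₁ u ∂F)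
    (TS TMM : MMBias.SlopeFunctional p)
    (hTS : MMBias.IsSFunctional ρ₁ b TS) (hTMM : MMBias.IsMMFunctional ρ₁ ρ₂ b TMM)
    (ε : ℝ) (hε₀ : 0 < ε) (hε₁ : ε < 1)
    (hS : MMBias.maxBias TS Ho ε < MMBias.inverse (MMBias.h₁ ρ₁ ρ₂ b Ho ε) (ε / (1 - ε))) :
    -- lower bound
    MMBias.inverse (MMBias.h₁ ρ₁ ρ₂ b Ho ε) (ε / (1 - ε)) ≤ MMBias.maxBias TMM Ho ε ∧
    -- upper bound at every contaminated distribution at which the MM-estimate exists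
    (∀ H ∈ MMBias.neighborhood Ho ε, ∀ θ, TMM H = some θ →
      ENNReal.ofReal ‖θ‖ ≤ MMBias.inverse (MMBias.h₂ ρ₁ ρ₂ b Ho ε) (ε / (1 - ε))) ∧
    -- upper bound for the maximum bias
    ((LowerSemicontinuous ρ₂ ∨ ∀ H ∈ MMBias.neighborhood Ho ε, TMM H ≠ none) →
      MMBias.maxBias TMM Ho ε ≤ MMBias.inverse (MMBias.h₂ ρ₁ ρ₂ b Ho ε) (ε / (1 - ε))) ∧
    -- comparison with the initial S-estimate
    MMBias.maxBias TS Ho ε < MMBias.maxBias TMM Ho ε := by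
  obtain rfl : Ho = F.prod G := hHo
  have hprob : ∀ H ∈ MMBias.neighborhood (F.prod G) ε, IsProbabilityMeasure H := by
    rintro _ ⟨H', hH', rfl⟩
    exact MMBias.isProbabilityMeasure_contaminate hε₀ hε₁ H'
  have hsol : ∀ B : ℝ, 0 ≤ B → MMBias.maxBias TS (F.prod G) ε ≤ ENNReal.ofReal B →
      ∀ H ∈ MMBias.neighborhood (F.prod G) ε,
        ∃ α θ, ‖θ‖ ≤ B ∧ MMBias.IsSSolution ρ₁ b H α θ (MMBias.sScale ρ₁ b H) := by
    intro B hB hle H hH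
    obtain ⟨θ, hθ, hθB⟩ := MMBias.exists_eq_some_of_maxBias_le hB hle hH
    obtain ⟨α, σ, hσ⟩ := (hTS H (hprob H hH)).1 θ hθ
    exact ⟨α, θ, hθB, hσ.sScale_eq ▸ hσ⟩
  -- The strict hypothesis makes the maximum bias of the S-estimate finite, so an S-solution exists
  -- on the whole neighbourhood.
  have hsol₀ := hsol _ ENNReal.toReal_nonneg (ENNReal.ofReal_toReal hS.ne_top).ge
  have hbε : b < 1 - ε := MMBias.lt_one_sub_of_exists_isSSolution hρ₁ hε₀ hε₁ fun H hH => by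
    obtain ⟨α, θ, -, h⟩ := hsol₀ H hH
    exact ⟨α, θ, _, h⟩
  have h1 : ∃ δ > 0, ρ₁ δ < 1 := MMBias.exists_loss_lt_one hρ₁ hF (by linarith)
  have h2 : ∃ δ > 0, ρ₂ δ < 1 := h1.imp fun δ h => ⟨h.1, (hρ δ).trans_lt h.2⟩
  have hbdd := MMBias.bddAbove_sScale hp hρ₁ h1 hF hε₀ hε₁ hb hbε ENNReal.toReal_nonneg hsol₀
  have hspos : ∀ H ∈ MMBias.neighborhood (F.prod G) ε, 0 < MMBias.sScale ρ₁ b H := fun H hH => by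
    obtain ⟨_, _, -, h, -⟩ := hsol₀ H hH
    exact h
  have hh₂ : ∀ H ∈ MMBias.neighborhood (F.prod G) ε, ∀ t,
      MMBias.h₂ ρ₁ ρ₂ b (F.prod G) ε t ≤ MMBias.m ρ₂ (F.prod G) t (MMBias.sScale ρ₁ b H) := by
    intro H hH t
    refine ciInf_le (f := fun s : Icc (MMBias.sLower ρ₁ b (F.prod G) ε)
      (MMBias.sUpper ρ₁ b (F.prod G) ε) => MMBias.m ρ₂ (F.prod G) t s)
      -- Without a lower bound the real infimum defining `h₂` would be a default value.
      ⟨-1, by rintro _ ⟨s, rfl⟩; exact MMBias.neg_one_le_m hρ₂ _ _ _⟩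
      ⟨MMBias.sScale ρ₁ b H, csInf_le ⟨0, ?_⟩ ⟨H, hH, rfl⟩, le_csSup hbdd ⟨H, hH, rfl⟩⟩
    rintro _ ⟨H₁, hH₁, rfl⟩
    exact (hspos H₁ hH₁).le
  have lower : MMBias.inverse (MMBias.h₁ ρ₁ ρ₂ b (F.prod G) ε) (ε / (1 - ε)) ≤
      MMBias.maxBias TMM (F.prod G) ε := by
    by_contra! hlt
    set B := (max (MMBias.maxBias TS (F.prod G) ε) (MMBias.maxBias TMM (F.prod G) ε)).toReal
    have hmax := max_lt hS hlt
    have hBeq : ENNReal.ofReal B = max _ _ := ENNReal.ofReal_toReal hmax.ne_top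
    obtain ⟨t', hBt, ht'⟩ := exists_between hmax
    have htt : ENNReal.ofReal t'.toReal = t' := ENNReal.ofReal_toReal ht'.ne_top
    have hle := MMBias.le_m_sUpper hp hρ₁ h1 hρ₂ h2 hF hG hε₀ hε₁ hbε
      (ENNReal.toReal_nonneg : 0 ≤ B) (hsol B ENNReal.toReal_nonneg ((le_max_left _ _).trans hBeq.ge)) hbdd
      (fun H hH => by
        obtain ⟨θ, hθ, hθB⟩ := MMBias.exists_eq_some_of_maxBias_le (T := TMM)
          (ENNReal.toReal_nonneg : 0 ≤ B) ((le_max_right _ _).trans hBeq.ge) hH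
        obtain ⟨α, h⟩ := (hTMM H (hprob H hH)).1 θ hθ
        exact ⟨α, θ, hθB, h⟩)
      ((ENNReal.toReal_lt_toReal hmax.ne_top ht'.ne_top).2 hBt)
    refine absurd ht' (not_lt.2 ?_)
    rw [← htt]
    exact iInf₂_le t'.toReal ⟨ENNReal.toReal_nonneg, hle⟩
  have upper : ∀ H ∈ MMBias.neighborhood (F.prod G) ε, ∀ θ, TMM H = some θ →
      ENNReal.ofReal ‖θ‖ ≤ MMBias.inverse (MMBias.h₂ ρ₁ ρ₂ b (F.prod G) ε) (ε / (1 - ε)) := by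
    intro H hH θ hθ
    refine le_iInf₂ fun t ht => ENNReal.ofReal_le_ofReal ?_
    by_contra! hlt
    obtain ⟨α, hα⟩ := (hTMM H (hprob H hH)).1 θ hθ
    have hm := ht.2.trans (hh₂ H hH t)
    obtain ⟨H', hH', rfl⟩ := hH
    exact absurd (MMBias.risk_zero_lt_of_lt_norm hp hρ₂ h2 hF hG hε₀ hε₁ hα.1 ht.1 hm H' α hlt)
      (not_lt.2 (hα.2 0 0))
  refine ⟨lower, upper, fun h => ?_, hS.trans_le lower⟩
  refine iSup₂_le fun H hH => ?_
  rcases hT : TMM H with _ | θ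
  · rcases h with hl | hdef
    -- Any `t` with `h₂ t ≥ ε / (1 - ε)` would give an MM-solution at `H`. Hence there is none, and
    -- the bound is `∞`.
    · refine le_iInf₂ fun t ht => ?_
      have hm := ht.2.trans (hh₂ H hH t)
      refine absurd ?_ ((hTMM H (hprob H hH)).2 hT)
      have hpos := hspos H hH
      obtain ⟨H', hH', rfl⟩ := hH
      obtain ⟨α, θ, hmin⟩ := MMBias.exists_forall_risk_le hp hρ₂ h2 hl hF hG hε₀ hε₁ hpos ht.1 hm H'
      exact ⟨α, θ, hpos, hmin⟩
    · exact absurd hT (hdef H hH)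
  · simpa [MMBias.bias, hT] using upper H hH θ hT
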